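/- Let $n \ge 0$ be an integer. Let $X=\begin{pmatrix}0&1\\1&0\end{pmatrix}$ and $Z=\begin{pmatrix}1&0\\0&-1\end{pmatrix}$. For $x=(p,q)\in\mathbb{F}_2^n\times\mathbb{F}_2^n=\mathbb{F}_2^{2n}$ let $$W_x = i^{p\cdot q}\,(X^{p_1}Z^{q_1})\otimes\cdots\otimes(X^{p_n}Z^{q_n})$$ be the Weyl operator, where $p\cdot q=\sum_j p_jq_j$ is computed over the integers. For an $n$-qubit pure state $|\psi\rangle$ (a unit vector of $(\mathbb{C}^2)^{\otimes n}$) let $$p_\psi(x)=2^{-n}|\langle\psi|W_x|\psi\rangle|^2,\qquad q_\psi(x)=\sum_{y\in\mathbb{F}_2^{2n}}p_\psi(y)\,p_\psi(x+y)$$ be its characteristic distribution and its Weyl distribution, so that $$\mathop{\mathbf{E}}_{x\sim q_\psi}\left[|\langle\psi|W_x|\psi\rangle|^2\right]=\sum_{x\in\mathbb{F}_2^{2n}}q_\psi(x)\,|\langle\psi|W_x|\psi\rangle|^2 .$$ The stabilizer states $\mathcal{S}_n$ are the states $C|0^n\rangle$ with $C$ in the Clifford group, the group of unitaries generated by the Hadamard,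 phase and CNOT gates on any of the $n$ qubits. The stabilizer fidelity of $|\psi\rangle$ is $F_{\mathcal{S}}(|\psi\rangle)=\max_{|\phi\rangle\in\mathcal{S}_n}|\langle\phi|\psi\rangle|^2$. 1. For every $n$-qubit pure state $|\psi\rangle$ and every real $k>0$, if $F_{\mathcal{S}}(|\psi\rangle)\ge \frac1k$, then $$\mathop{\mathbf{E}}_{x\sim q_\psi}\left[|\langle\psi|W_x|\psi\rangle|^2\right]\ge\frac{1}{k^6}.$$ 2. If $n\ge 33$ and $|\psi\rangle$ is a Haar-random $n$-qubit pure state (uniformly distributed on the unit sphere of $(\mathbb{C}^2)^{\otimes n}$), then, with probability at least $1-\exp\left(-2^{n/2-15}\right)$, $$\mathop{\mathbf{E}}_{x\sim q_\psi}\left[|\langle\psi|W_x|\psi\rangle|^2\right]\le 2^{-n/2}.$$ -/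

import Mathlib

noncomputable section

open Matrix MeasureTheory

namespace StabFid

/-- Bit strings of length `n`, that is `𝔽₂ⁿ`. -/
abbrev Bits (n : ℕ) : Type := Fin n → ZMod 2

/-- The state space `(ℂ²)^{⊗ n}`, in coordinates for the computational basis. -/
abbrev Space (n : ℕ) : Type := EuclideanSpace ℂ (Bits n)

/-- `n`-qubit pure states: unit vectors of the state space. -/
abbrev PureState (n : ℕ) : Type := Metric.sphere (0 : Space n) 1

/-- A one-qubit operator. -/
abbrev Mat1 : Type := Matrix (ZMod 2) (ZMod 2) ℂ

/-- An `n`-qubit operator. -/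
abbrev Mat (n : ℕ) : Type := Matrix (Bits n) (Bits n) ℂ

/-- The action of an operator on a vector. -/
def act {n : ℕ} (A : Mat n) (v : Space n) : Space n := WithLp.toLp 2 (A *ᵥ v.ofLp)

/-- The tensor product `A₁ ⊗ ⋯ ⊗ Aₙ` of one-qubit operators. -/
def tensor {n : ℕ} (A : Fin n → Mat1) : Mat n :=
  Matrix.of fun r s => ∏ j, A j (r j) (s j)

/-- The Pauli matrix `X`. -/
def pauliX : Mat1 := Matrix.of fun a b => if a = b then 0 else 1

/-- The Pauli matrix `Z = diag(1, -1)`. -/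
def pauliZ : Mat1 := Matrix.diagonal fun a => (-1 : ℂ) ^ a.val

/-- The Weyl operator `W_x = i^{p·q} (X^{p₁} Z^{q₁}) ⊗ ⋯ ⊗ (X^{pₙ} Z^{qₙ})` for
`x = (p, q) ∈ 𝔽₂ⁿ × 𝔽₂ⁿ`; the exponent `p·q` of `i` is computed over the integers. -/
def weyl {n : ℕ} (x : Bits n × Bits n) : Mat n :=
  Complex.I ^ (∑ j, (x.1 j).val * (x.2 j).val) •
    tensor fun j => pauliX ^ (x.1 j).val * pauliZ ^ (x.2 j).val

/-- `⟨ψ|W_x|ψ⟩`. -/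
def weylAmp {n : ℕ} (ψ : PureState n) (x : Bits n × Bits n) : ℂ :=
  inner ℂ (ψ : Space n) (act (weyl x) ψ)

/-- The characteristic distribution `p_ψ(x) = 2^{-n} |⟨ψ|W_x|ψ⟩|²`. -/
def charDist {n : ℕ} (ψ : PureState n) (x : Bits n × Bits n) : ℝ :=
  ‖weylAmp ψ x‖ ^ 2 / 2 ^ n

/-- The Weyl distribution `q_ψ(x) = ∑_y p_ψ(y) p_ψ(x + y)`. -/
def weylDist {n : ℕ} (ψ : PureState n) (x : Bits n × Bits n) : ℝ :=
  ∑ y, charDist ψ y * charDist ψ (x + y)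

/-- The expectation of `|⟨ψ|W_x|ψ⟩|²` for `x` drawn from the Weyl distribution `q_ψ`. -/
def weylExpectation {n : ℕ} (ψ : PureState n) : ℝ :=
  ∑ x, weylDist ψ x * ‖weylAmp ψ x‖ ^ 2

/-- The one-qubit operator `A` applied to qubit `j`. -/
def onQubit {n : ℕ} (j : Fin n) (A : Mat1) : Mat n :=
  tensor (Function.update (fun _ => (1 : Mat1)) j A)

/-- The Hadamard gate. -/
def hadamardGate : Mat1 := Matrix.of fun a b => (-1 : ℂ) ^ (a.val * b.val) / (Real.sqrt 2 : ℂ)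

/-- The phase gate `S = diag(1, i)`. -/
def phaseGate : Mat1 := Matrix.diagonal fun a => Complex.I ^ a.val

/-- The controlled-not gate with control qubit `a` and target qubit `b`: it maps the basis vector
`|s⟩` to `|s'⟩`, where `s'` agrees with `s` except that `s'_b = s_b + s_a`. -/
def cnot {n : ℕ} (a b : Fin n) : Mat n :=
  Matrix.of fun r s => if r = Function.update s b (s b + s a) then 1 else 0

/-- An operator is a gate if it is Hadamard, phase or controlled-not, on any choice of qubits. -/
def IsCliffordGate {n : ℕ} (A : Mat n) : Prop :=
  (∃ j, A = onQubit j hadamardGate) ∨ (∃ j, A = onQubit j phaseGate) ∨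
    ∃ a b, a ≠ b ∧ A = cnot a b

/-- The Clifford group: the group of unitaries generated by the gates `H`, `S` and `CNOT`. -/
def cliffordGroup (n : ℕ) : Subgroup (Matrix.unitaryGroup (Bits n) ℂ) :=
  Subgroup.closure {U | IsCliffordGate (U : Mat n)}

/-- The basis vector `|0ⁿ⟩`. -/
def ketZero (n : ℕ) : Space n := EuclideanSpace.single (0 : Bits n) (1 : ℂ)

/-- The stabilizer states: those reached from `|0ⁿ⟩` by a Clifford circuit. -/
def stabilizerStates (n : ℕ) : Set (PureState n) :=
  {φ | ∃ C ∈ cliffordGroup n, (φ : Space n) = act (C : Mat n) (ketZero n)}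

/-- The stabilizer fidelity: the largest value of `|⟨φ|ψ⟩|²` over all stabilizer states `φ`. -/
def stabilizerFidelity {n : ℕ} (ψ : PureState n) : ℝ :=
  sSup ((fun φ : PureState n => ‖inner ℂ (φ : Space n) (ψ : Space n)‖ ^ 2) ''
    stabilizerStates n)

/-- The Haar measure on pure states: the surface measure of the unit sphere, normalized to be a
probability measure. -/
def haarState (n : ℕ) : Measure (PureState n) :=
  ((volume : Measure (Space n)).toSphere Set.univ)⁻¹ • (volume : Measure (Space n)).toSphere

instance haarState_isProbabilityMeasure (n : ℕ) : IsProbabilityMeasure (haarState n) := by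
  constructor
  have h : (volume : Measure (Space n)).toSphere Set.univ ≠ 0 := by
    rw [Ne, Measure.measure_univ_eq_zero]
    exact Measure.toSphere_ne_zero _
  simp only [haarState, Measure.smul_apply, smul_eq_mul]
  exact ENNReal.inv_mul_cancel h (measure_ne_top _ _)

end StabFid

end

/-!
Write `f x = ‖⟨ψ|W_x|ψ⟩‖²`. Expanding in coordinates and summing characters of `𝔽₂ⁿ` shows that `f`
is its own symplectic Fourier transform up to the factor `2ⁿ` (`sum_sympSign_mul`). The Weyl
expectation is a value of the triple convolution of `f` with itself, so it equals `2⁻ⁿ ∑ₓ f(x)³`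
(`weylExpectation_eq`), and `∑ₓ f(x) = 2ⁿ`.

For the lower bound, let `φ = C|0ⁿ⟩` be a stabilizer state and `χ = C†ψ`. The Clifford unitary `C`
permutes the Weyl operators up to phases (`permutesWeyl_of_mem_cliffordGroup`), so `ψ` and `χ` have
the same sixth moment. As `|0ⁿ⟩⟨0ⁿ|` is the average of the `2ⁿ` products of Pauli `Z`s, the overlap
`‖⟨φ|ψ⟩‖² = ‖⟨0ⁿ|χ⟩‖²` is at most the average of `‖⟨χ|W_x|χ⟩‖` over `x = (0, q)`, and the power mean
inequality bounds its sixth power by the sixth moment (`fidelity_pow_six_le`).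

For the upper bound, if all nontrivial amplitudes are at most `t`, the sixth moment is at most
`2⁻ⁿ + t⁴` (`weylExpectation_le_of_forall_norm_le`). That this is likely follows from a union bound
over the `4ⁿ` Weyl operators and a volume argument in place of Lévy's lemma
(`toSphere_setOf_le_inner`): a suitable `L = a - b W_x` maps the part of the unit ball where
`t ‖v‖² ≤ ⟨v|W_x|v⟩` into the unit ball, and its determinant can be computed because `W_x`
anticommutes with another Weyl operator.
-/

noncomputable section

open Matrix MeasureTheory
open scoped Pointwise

namespace StabFid

/-! ### Concentration of a balanced quadratic form on the sphere -/

/-- If `V` anticommutes with `W` and both are involutions, then `a + b W` and `a - b W` are conjugate,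
so the square of their common determinant is the determinant of the scalar `a² - b²`. -/
theorem det_sq_of_anticommute {E : Type*} [AddCommGroup E] [Module ℝ E]
    {V W : E →ₗ[ℝ] E} (hV : V * V = 1) (hW : W * W = 1) (hVW : V * W = -(W * V)) (a b : ℝ) :
    LinearMap.det (a • (1 : E →ₗ[ℝ] E) - b • W) ^ 2 = (a ^ 2 - b ^ 2) ^ Module.finrank ℝ E := by
  have hVd : LinearMap.det V * LinearMap.det V = 1 := by
    rw [← map_mul, hV, map_one]
  have hconj : V * (a • (1 : E →ₗ[ℝ] E) - b • W) * V = a • (1 : E →ₗ[ℝ] E) + b • W := by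
    simp only [mul_sub, add_mul, mul_smul_comm, smul_mul_assoc, mul_one, hV, hVW,
      mul_assoc, smul_neg, sub_neg_eq_add]
  have hprod : (a • (1 : E →ₗ[ℝ] E) - b • W) * (a • (1 : E →ₗ[ℝ] E) + b • W)
      = (a ^ 2 - b ^ 2) • (1 : E →ₗ[ℝ] E) := by
    simp only [mul_add, sub_mul, mul_smul_comm, smul_mul_assoc, mul_one, one_mul, hW, smul_smul,
      smul_sub, sub_smul]
    rw [pow_two, pow_two, mul_comm a b]
    abel
  have hdet := congrArg LinearMap.det hconj
  rw [map_mul, map_mul, mul_right_comm, hVd, one_mul] at hdet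
  rw [sq]
  nth_rewrite 2 [hdet]
  rw [← map_mul, hprod, LinearMap.det_smul, map_one, mul_one]

/-- A quadratic form `⟪ψ, W ψ⟫` given by a symmetric involution `W` whose two eigenspaces are
exchanged by another involution `V` exceeds `t` only on an exponentially small part of the sphere.
With `b / a = t / 2` suitably normalized, `a - b W` shrinks every vector `v` of the cone
`t ‖v‖² ≤ ⟪v, W v⟫`, so it maps the part of the unit ball in that cone into the unit ball, while it
expands the volume by at least `exp (dim E * t² / 4)`. -/
theorem toSphere_setOf_le_inner {E : Type*} [NormedAddCommGroup E] [InnerProductSpace ℝ E]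
    [FiniteDimensional ℝ E] [MeasurableSpace E] [BorelSpace E] (μ : Measure E) [μ.IsAddHaarMeasure]
    {V W : E →ₗ[ℝ] E} (hV : V * V = 1) (hW : W * W = 1) (hVW : V * W = -(W * V))
    (hsymm : W.IsSymmetric) {t : ℝ} (ht0 : 0 ≤ t) (ht1 : t ≤ 1) :
    ENNReal.ofReal (Real.exp (Module.finrank ℝ E * (t ^ 2 / 4))) *
        μ.toSphere {ψ : Metric.sphere (0 : E) 1 | t ≤ inner ℝ (ψ : E) (W ψ)} ≤
      μ.toSphere Set.univ := by
  have hc : 0 < 1 - 3 * t ^ 2 / 4 := by nlinarith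
  -- The normalization that makes `‖a v - b W v‖ ≤ ‖v‖` an equality on the boundary of the cone.
  set a : ℝ := (Real.sqrt (1 - 3 * t ^ 2 / 4))⁻¹ with ha
  have ha0 : 0 < a := by positivity
  have ha2 : a ^ 2 * (1 - 3 * t ^ 2 / 4) = 1 := by
    rw [ha, inv_pow, Real.sq_sqrt hc.le, inv_mul_cancel₀ hc.ne']
  set b : ℝ := a * (t / 2) with hb
  set L : E →ₗ[ℝ] E := a • (1 : E →ₗ[ℝ] E) - b • W with hL
  have hexp : Real.exp (t ^ 2 / 2) ≤ a ^ 2 - b ^ 2 := by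
    have h1 : 1 - t ^ 2 / 2 ≤ Real.exp (-(t ^ 2 / 2)) := Real.one_sub_le_exp_neg _
    have h2 : 1 ≤ (a ^ 2 - b ^ 2) * (1 - t ^ 2 / 2) := by
      rw [hb]
      have : (a ^ 2 - (a * (t / 2)) ^ 2) * (1 - t ^ 2 / 2)
          = a ^ 2 * (1 - 3 * t ^ 2 / 4) + a ^ 2 * (t ^ 2) ^ 2 / 8 := by ring
      rw [this, ha2]
      have : 0 ≤ a ^ 2 * (t ^ 2) ^ 2 / 8 := by positivity
      linarith
    have h3 : 0 ≤ a ^ 2 - b ^ 2 := by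
      rw [hb]; nlinarith [mul_pos ha0 ha0]
    have h4 : 1 ≤ (a ^ 2 - b ^ 2) * Real.exp (-(t ^ 2 / 2)) :=
      h2.trans (mul_le_mul_of_nonneg_left h1 h3)
    rw [Real.exp_neg, ← div_eq_mul_inv, le_div_iff₀ (Real.exp_pos _), one_mul] at h4
    exact h4
  have hdet : Real.exp (Module.finrank ℝ E * (t ^ 2 / 4)) ≤ |LinearMap.det L| := by
    refine le_of_sq_le_sq ?_ (abs_nonneg _)
    rw [sq_abs, hL, det_sq_of_anticommute hV hW hVW, ← Real.exp_nat_mul]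
    calc Real.exp _ = Real.exp (t ^ 2 / 2) ^ Module.finrank ℝ E := by
          rw [← Real.exp_nat_mul]; congr 1; push_cast; ring
      _ ≤ _ := pow_le_pow_left₀ (Real.exp_pos _).le hexp _
  set S : Set (Metric.sphere (0 : E) 1) := {ψ | t ≤ inner ℝ (ψ : E) (W ψ)} with hS
  have hSm : MeasurableSet S := by
    have : Continuous fun ψ : Metric.sphere (0 : E) 1 => inner ℝ (ψ : E) (W ψ) :=
      continuous_subtype_val.inner
        ((LinearMap.continuous_of_finiteDimensional W).comp continuous_subtype_val)
    exact measurableSet_le measurable_const this.measurable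
  have himage : L '' (Set.Ioo (0 : ℝ) 1 • (Subtype.val '' S)) ⊆ Metric.ball 0 1 := by
    rintro _ ⟨_, ⟨r, hr, _, ⟨ψ, hψ, rfl⟩, rfl⟩, rfl⟩
    have hψn : ‖(ψ : E)‖ = 1 := by simp
    have hWn : ‖W ψ‖ ^ 2 = 1 := by
      rw [← real_inner_self_eq_norm_sq, hsymm, ← Module.End.mul_apply, hW, Module.End.one_apply,
        real_inner_self_eq_norm_sq, hψn, one_pow]
    have hLn : ‖L ψ‖ ^ 2 ≤ 1 := by
      have : L ψ = a • (ψ : E) - b • W ψ := by simp [hL]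
      rw [this, norm_sub_sq_real, norm_smul, norm_smul, mul_pow, mul_pow, hWn, hψn,
        real_inner_smul_left, real_inner_smul_right, Real.norm_eq_abs, Real.norm_eq_abs, sq_abs,
        sq_abs]
      have hq : t ≤ inner ℝ (ψ : E) (W ψ) := hψ
      have : a * (b * t) ≤ a * (b * inner ℝ (ψ : E) (W ψ)) := by gcongr
      have h2 : a ^ 2 + b ^ 2 - 2 * (a * (b * t)) = a ^ 2 * (1 - 3 * t ^ 2 / 4) := by
        rw [hb]; ring
      linarith
    have hLn' : ‖L ψ‖ ≤ 1 := by nlinarith [norm_nonneg (L ψ)]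
    simp only [map_smul, Metric.mem_ball, dist_zero_right, norm_smul, Real.norm_eq_abs,
      abs_of_pos hr.1]
    nlinarith [hr.1, hr.2, norm_nonneg (L ψ)]
  rw [Measure.toSphere_apply_univ, Measure.toSphere_apply' _ hSm, mul_left_comm]
  gcongr
  calc _ ≤ ENNReal.ofReal |LinearMap.det L| * μ (Set.Ioo (0 : ℝ) 1 • (Subtype.val '' S)) := by
        gcongr
    _ = μ (L '' (Set.Ioo (0 : ℝ) 1 • (Subtype.val '' S))) :=
        (Measure.addHaar_image_linearMap μ L _).symm
    _ ≤ μ (Metric.ball 0 1) := measure_mono himage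

/-! ### Characters of `𝔽₂ⁿ` and the entries of the Weyl operators -/

/-- The nontrivial character `a ↦ (-1)ᵃ` of `𝔽₂`, with complex values. -/
def parity (a : ZMod 2) : ℂ := (-1) ^ a.val

theorem forall_zmod_two {P : ZMod 2 → Prop} : (∀ a, P a) ↔ P 0 ∧ P 1 :=
  ⟨fun h => ⟨h 0, h 1⟩, fun h a => by fin_cases a; exacts [h.1, h.2]⟩

theorem one_add_one_zmod_two : (1 + 1 : ZMod 2) = 0 := rfl

@[simp] theorem parity_zero : parity 0 = 1 := by simp [parity]

@[simp] theorem parity_one : parity 1 = -1 := by simp [parity, ZMod.val_one]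

theorem parity_add (a b : ZMod 2) : parity (a + b) = parity a * parity b := by
  revert a b
  simp [forall_zmod_two, one_add_one_zmod_two]

theorem parity_sum {ι : Type*} (s : Finset ι) (f : ι → ZMod 2) :
    parity (∑ i ∈ s, f i) = ∏ i ∈ s, parity (f i) := by
  classical
  induction s using Finset.induction_on with
  | empty => simp
  | insert i s hi ih => rw [Finset.sum_insert hi, Finset.prod_insert hi, parity_add, ih]

@[simp] theorem star_parity (a : ZMod 2) : star (parity a) = parity a := by
  simp [parity]

@[simp] theorem norm_parity (a : ZMod 2) : ‖parity a‖ = 1 := by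
  simp [parity]

theorem bits_add_self {n : ℕ} (s : Bits n) : s + s = 0 :=
  funext fun j => CharTwo.add_self_eq_zero (s j)

theorem sum_parity_dotProduct {n : ℕ} (s : Bits n) :
    ∑ q : Bits n, parity (q ⬝ᵥ s) = if s = 0 then 2 ^ n else 0 := by
  split_ifs with hs
  · simp [hs, ZMod.card]
  · obtain ⟨j, hj⟩ := Function.ne_iff.mp hs
    have h1 : s j = 1 := by
      have : ∀ a : ZMod 2, a ≠ 0 → a = 1 := by decide
      exact this _ hj
    have h := Equiv.sum_comp (Equiv.addRight (Pi.single j (1 : ZMod 2) : Bits n))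
      fun q => parity (q ⬝ᵥ s)
    simp only [Equiv.coe_addRight, add_dotProduct, single_dotProduct, h1, parity_add,
      parity_one, mul_neg, mul_one, Finset.sum_neg_distrib] at h
    linear_combination -(1 / 2 : ℂ) * h

/-- The one-qubit factor `X^p Z^q` of a Weyl operator. -/
def pauli (p q : ZMod 2) : Mat1 := pauliX ^ p.val * pauliZ ^ q.val

theorem pauli_apply (p q a b : ZMod 2) :
    pauli p q a b = if a = b + p then parity (q * b) else 0 := by
  revert p q a b
  simp [forall_zmod_two, pauli, pauliX, pauliZ, ZMod.val_one, one_add_one_zmod_two]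

theorem weyl_eq {n : ℕ} (x : Bits n × Bits n) :
    weyl x = Complex.I ^ (∑ j, (x.1 j).val * (x.2 j).val) •
      tensor fun j => pauli (x.1 j) (x.2 j) := rfl

theorem weyl_apply {n : ℕ} (x : Bits n × Bits n) (r s : Bits n) :
    weyl x r s = Complex.I ^ (∑ j, (x.1 j).val * (x.2 j).val) *
      if r = s + x.1 then parity (x.2 ⬝ᵥ s) else 0 := by
  rw [weyl_eq, Matrix.smul_apply, smul_eq_mul]
  congr 1
  simp only [tensor, Matrix.of_apply, pauli_apply]
  split_ifs with h
  · subst h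
    simp [dotProduct, parity_sum]
  · obtain ⟨j, hj⟩ := Function.ne_iff.mp h
    exact Finset.prod_eq_zero (Finset.mem_univ j) (if_neg hj)

theorem tensor_mul {n : ℕ} (A B : Fin n → Mat1) :
    tensor A * tensor B = tensor fun j => A j * B j := by
  ext r s
  simp only [tensor, Matrix.mul_apply, Matrix.of_apply, Finset.prod_univ_sum,
    Fintype.piFinset_univ, Finset.prod_mul_distrib]

theorem tensor_smul {n : ℕ} (c : Fin n → ℂ) (A : Fin n → Mat1) :
    (tensor fun j => c j • A j) = (∏ j, c j) • tensor A := by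
  ext r s
  simp [tensor, Finset.prod_mul_distrib]

/-! ### Clifford gates permute the Weyl operators -/

/-- Conjugation by `U` permutes the Weyl operators up to phases. -/
def PermutesWeyl {n : ℕ} (U : Mat n) : Prop :=
  ∃ π : Equiv.Perm (Bits n × Bits n), ∀ x, ∃ c : ℂ, ‖c‖ = 1 ∧ U * weyl x = c • (weyl (π x) * U)

theorem permutesWeyl_one {n : ℕ} : PermutesWeyl (1 : Mat n) :=
  ⟨Equiv.refl _, fun x => ⟨1, by simp, by simp⟩⟩

theorem PermutesWeyl.mul {n : ℕ} {U V : Mat n} (hU : PermutesWeyl U) (hV : PermutesWeyl V) :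
    PermutesWeyl (U * V) := by
  obtain ⟨π, hπ⟩ := hU
  obtain ⟨ρ, hρ⟩ := hV
  refine ⟨ρ.trans π, fun x => ?_⟩
  obtain ⟨c, hc, h⟩ := hρ x
  obtain ⟨d, hd, h'⟩ := hπ (ρ x)
  refine ⟨c * d, by simp [hc, hd], ?_⟩
  rw [Matrix.mul_assoc, h, Matrix.mul_smul, ← Matrix.mul_assoc, h', Matrix.smul_mul, smul_smul,
    Matrix.mul_assoc]
  rfl

theorem PermutesWeyl.of_inverse {n : ℕ} {U V : Mat n} (hU : PermutesWeyl U) (hVU : V * U = 1)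
    (hUV : U * V = 1) : PermutesWeyl V := by
  obtain ⟨π, hπ⟩ := hU
  refine ⟨π.symm, fun x => ?_⟩
  obtain ⟨c, hc, h⟩ := hπ (π.symm x)
  have hc0 : c ≠ 0 := by rintro rfl; simp at hc
  refine ⟨c⁻¹, by simp [hc], ?_⟩
  rw [Equiv.apply_symm_apply] at h
  have h2 := congrArg (fun M => V * M * V) h
  simp only [Matrix.mul_smul, Matrix.smul_mul, ← Matrix.mul_assoc, hVU, Matrix.one_mul] at h2
  rw [Matrix.mul_assoc _ U V, hUV, Matrix.mul_one] at h2
  rw [h2, smul_smul, inv_mul_cancel₀ hc0, one_smul]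

/-- A product operator permutes the Weyl operators if each factor does so on its own qubit. -/
theorem permutesWeyl_tensor {n : ℕ} (A : Fin n → Mat1) (π : Equiv.Perm (Bits n × Bits n))
    (h : ∀ x j, ∃ c : ℂ, ‖c‖ = 1 ∧
      A j * pauli (x.1 j) (x.2 j) = c • (pauli ((π x).1 j) ((π x).2 j) * A j)) :
    PermutesWeyl (tensor A) := by
  refine ⟨π, fun x => ?_⟩
  choose c hc hcA using h x
  refine ⟨Complex.I ^ (∑ j, (x.1 j).val * (x.2 j).val) *
    (Complex.I ^ (∑ j, ((π x).1 j).val * ((π x).2 j).val))⁻¹ * ∏ j, c j, ?_, ?_⟩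
  · simp [hc]
  · rw [weyl_eq, weyl_eq, Matrix.mul_smul, Matrix.smul_mul, tensor_mul, tensor_mul, smul_smul]
    simp only [hcA]
    rw [tensor_smul, smul_smul]
    congr 1
    have : Complex.I ^ (∑ j, ((π x).1 j).val * ((π x).2 j).val) ≠ 0 :=
      pow_ne_zero _ Complex.I_ne_zero
    field_simp

theorem permutesWeyl_hadamard {n : ℕ} (j : Fin n) : PermutesWeyl (onQubit j hadamardGate) := by
  have hinv : Function.Involutive fun x : Bits n × Bits n =>
      (Function.update x.1 j (x.2 j), Function.update x.2 j (x.1 j)) := by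
    intro x
    simp
  refine permutesWeyl_tensor _ hinv.toPerm fun x i => ?_
  rcases eq_or_ne i j with rfl | hij
  · refine ⟨parity (x.1 i * x.2 i), norm_parity _, ?_⟩
    simp only [Function.update_self, Function.Involutive.coe_toPerm]
    generalize x.1 i = p
    generalize x.2 i = q
    ext a b
    have hz : ∀ f : ZMod 2 → ℂ, ∑ k, f k = f 0 + f 1 := Fin.sum_univ_two
    simp only [Matrix.mul_apply, Matrix.smul_apply, pauli_apply, hz, hadamardGate, Matrix.of_apply,
      smul_eq_mul]
    revert p q a b
    simp [forall_zmod_two, ZMod.val_one, one_add_one_zmod_two, neg_div]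
  · exact ⟨1, by simp, by simp [Function.update_of_ne hij]⟩

theorem permutesWeyl_phase {n : ℕ} (j : Fin n) : PermutesWeyl (onQubit j phaseGate) := by
  have hinv : Function.Involutive fun x : Bits n × Bits n =>
      (x.1, Function.update x.2 j (x.2 j + x.1 j)) := by
    intro x
    simp [add_assoc, CharTwo.add_self_eq_zero]
  refine permutesWeyl_tensor _ hinv.toPerm fun x i => ?_
  rcases eq_or_ne i j with rfl | hij
  · refine ⟨Complex.I ^ (x.1 i).val, by simp, ?_⟩
    simp only [Function.update_self, Function.Involutive.coe_toPerm]
    generalize x.1 i = p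
    generalize x.2 i = q
    ext a b
    have hz : ∀ f : ZMod 2 → ℂ, ∑ k, f k = f 0 + f 1 := Fin.sum_univ_two
    simp only [Matrix.mul_apply, Matrix.smul_apply, pauli_apply, hz, phaseGate,
      Matrix.diagonal_apply, smul_eq_mul]
    revert p q a b
    simp [forall_zmod_two, ZMod.val_one, one_add_one_zmod_two]
  · exact ⟨1, by simp, by simp [Function.update_of_ne hij]⟩

theorem update_add_eq_add_single {n : ℕ} (s : Bits n) (j : Fin n) (c : ZMod 2) :
    Function.update s j (s j + c) = s + Pi.single j c := by
  ext i
  rcases eq_or_ne i j with rfl | hij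
  · simp
  · simp [hij]

theorem permutesWeyl_cnot {n : ℕ} {a b : Fin n} (hab : a ≠ b) :
    PermutesWeyl (cnot a b : Mat n) := by
  have hself : ∀ {j : Fin n} (c : ZMod 2), (Pi.single j c : Bits n) + Pi.single j c = 0 :=
    fun c => bits_add_self _
  have hinv : Function.Involutive fun x : Bits n × Bits n =>
      (x.1 + Pi.single b (x.1 a), x.2 + Pi.single a (x.2 b)) := by
    intro x
    simp [add_assoc, hself, hab, hab.symm]
  have hf : Function.Involutive fun s : Bits n => s + Pi.single b (s a) := by
    intro s
    simp [add_assoc, hself, hab]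
  have hcnot : ∀ r s : Bits n, cnot a b r s = if r = s + Pi.single b (s a) then 1 else 0 := by
    intro r s
    simp [cnot, update_add_eq_add_single]
  have hleft : ∀ (M : Mat n) r s, (cnot a b * M) r s = M (r + Pi.single b (r a)) s := by
    intro M r s
    rw [Matrix.mul_apply, Finset.sum_eq_single (r + Pi.single b (r a))]
    · rw [hcnot, if_pos (hf r).symm, one_mul]
    · intro k _ hk
      rw [hcnot, if_neg, zero_mul]
      rintro rfl
      exact hk (hf k).symm
    · simp
  have hright : ∀ (M : Mat n) r s, (M * cnot a b) r s = M r (s + Pi.single b (s a)) := by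
    intro M r s
    simp [Matrix.mul_apply, hcnot]
  obtain ⟨π, hπ⟩ : ∃ π : Equiv.Perm (Bits n × Bits n),
      ∀ x, π x = (x.1 + Pi.single b (x.1 a), x.2 + Pi.single a (x.2 b)) :=
    ⟨hinv.toPerm, fun _ => rfl⟩
  refine ⟨π, fun x => ⟨Complex.I ^ (∑ j, (x.1 j).val * (x.2 j).val) *
    (Complex.I ^ (∑ j, ((π x).1 j).val * ((π x).2 j).val))⁻¹, by simp, ?_⟩⟩
  ext r s
  have hI : ∀ k, Complex.I ^ k ≠ 0 := fun k => pow_ne_zero _ Complex.I_ne_zero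
  rw [hleft, Matrix.smul_apply, hright, weyl_apply, weyl_apply, smul_eq_mul, mul_assoc,
    inv_mul_cancel_left₀ (hI _)]
  congr 1
  have hiff : r + Pi.single b (r a) = s + x.1 ↔
      r = s + Pi.single b (s a) + (x.1 + Pi.single b (x.1 a)) := by
    have : s + Pi.single b (s a) + (x.1 + Pi.single b (x.1 a))
        = (s + x.1) + Pi.single b ((s + x.1) a) := by
      rw [Pi.add_apply, Pi.single_add]; abel
    rw [this]
    constructor
    · intro h; rw [← h]; exact (hf r).symm
    · rintro rfl; exact hf _
  have hdot : (x.2 + Pi.single a (x.2 b)) ⬝ᵥ (s + Pi.single b (s a)) = x.2 ⬝ᵥ s := by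
    simp only [add_dotProduct, dotProduct_add, single_dotProduct, dotProduct_single,
      Pi.add_apply, Pi.single_eq_of_ne hab.symm, add_zero, add_assoc, CharTwo.add_self_eq_zero]
  simp only [hπ, hiff, hdot]

/-- Clifford unitaries permute the Weyl operators up to phases; it suffices to check this on the
generating gates. -/
theorem permutesWeyl_of_mem_cliffordGroup {n : ℕ} {C : Matrix.unitaryGroup (Bits n) ℂ}
    (hC : C ∈ cliffordGroup n) : PermutesWeyl (C : Mat n) := by
  refine Subgroup.closure_induction 
    (p := fun (C : Matrix.unitaryGroup (Bits n) ℂ) _ => PermutesWeyl (C : Mat n)) ?_ ?_ ?_ ?_ hC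
  · rintro U (⟨j, hU⟩ | ⟨j, hU⟩ | ⟨a, b, hab, hU⟩)
    · simpa only [hU] using permutesWeyl_hadamard j
    · simpa only [hU] using permutesWeyl_phase j
    · simpa only [hU] using permutesWeyl_cnot hab
  · exact permutesWeyl_one
  · intro U V _ _ hU hV
    exact hU.mul hV
  · intro U _ hU
    refine hU.of_inverse ?_ ?_
    · exact congrArg Subtype.val (inv_mul_cancel U)
    · exact congrArg Subtype.val (mul_inv_cancel U)

/-! ### The sixth-moment formula for the Weyl expectation -/

/-- The amplitude `⟨v|W_x|v⟩` without the phase `i^{p·q}`, in coordinates. -/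
def weylCoeff {n : ℕ} (v : Bits n → ℂ) (x : Bits n × Bits n) : ℂ :=
  ∑ s, parity (x.2 ⬝ᵥ s) * (v s * star (v (s + x.1)))

theorem weylAmp_eq {n : ℕ} (ψ : PureState n) (x : Bits n × Bits n) :
    weylAmp ψ x = Complex.I ^ (∑ j, (x.1 j).val * (x.2 j).val) *
      weylCoeff (ψ : Space n).ofLp x := by
  have hiff : ∀ r s : Bits n, r = s + x.1 ↔ s = r + x.1 := fun r s => by
    constructor <;> rintro rfl <;> rw [add_assoc, bits_add_self, add_zero]
  have h : ∀ r, (weyl x *ᵥ (ψ : Space n).ofLp) r =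
      Complex.I ^ (∑ j, (x.1 j).val * (x.2 j).val) *
        (parity (x.2 ⬝ᵥ (r + x.1)) * (ψ : Space n) (r + x.1)) := by
    intro r
    simp [Matrix.mulVec, dotProduct, weyl_apply, hiff r, mul_assoc]
  simp only [weylAmp, act, PiLp.inner_apply, h, RCLike.inner_apply, weylCoeff, Finset.mul_sum]
  rw [← Equiv.sum_comp (Equiv.addRight x.1)]
  refine Finset.sum_congr rfl fun s _ => ?_
  rw [Equiv.coe_addRight, add_assoc, bits_add_self, add_zero, starRingEnd_apply]
  ring

theorem norm_weylAmp_eq {n : ℕ} (ψ : PureState n) (x : Bits n × Bits n) :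
    ‖weylAmp ψ x‖ = ‖weylCoeff (ψ : Space n).ofLp x‖ := by
  simp [weylAmp_eq]

/-- The squared amplitudes are, up to the factor `2ⁿ`, their own symplectic Fourier transform. -/
theorem sum_parity_mul_weylCoeff {n : ℕ} (v : Bits n → ℂ) (y : Bits n × Bits n) :
    ∑ x : Bits n × Bits n, parity (x.1 ⬝ᵥ y.2 + x.2 ⬝ᵥ y.1) *
      (weylCoeff v x * star (weylCoeff v x)) = 2 ^ n * (weylCoeff v y * star (weylCoeff v y)) := by
  have hiff : ∀ s u : Bits n, y.1 + (s + u) = 0 ↔ u = s + y.1 := by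
    intro s u
    rw [← add_assoc, add_comm y.1 s]
    constructor
    · intro h
      rw [← zero_add u, ← bits_add_self (s + y.1), add_assoc, h, add_zero]
    · rintro rfl; exact bits_add_self _
  have hleft : ∀ p : Bits n, ∑ q : Bits n, parity (p ⬝ᵥ y.2 + q ⬝ᵥ y.1) *
      (weylCoeff v (p, q) * star (weylCoeff v (p, q))) =
      2 ^ n * ∑ s, parity (p ⬝ᵥ y.2) *
        (v s * star (v (s + p)) * (star (v (s + y.1)) * v (s + y.1 + p))) := by
    intro p
    calc _ = ∑ s, ∑ u, (∑ q : Bits n, parity (q ⬝ᵥ (y.1 + (s + u)))) * (parity (p ⬝ᵥ y.2) *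
          (v s * star (v (s + p)) * (star (v u) * v (u + p)))) := by
          simp only [weylCoeff, star_sum, Finset.sum_mul_sum]
          simp only [Finset.mul_sum, Finset.sum_mul]
          rw [Finset.sum_comm]
          refine Finset.sum_congr rfl fun s _ => ?_
          rw [Finset.sum_comm]
          refine Finset.sum_congr rfl fun u _ => Finset.sum_congr rfl fun q _ => ?_
          simp only [dotProduct_add, parity_add, star_mul', star_parity, star_star]
          ring
      _ = _ := by
          simp only [sum_parity_dotProduct, hiff, ite_mul, zero_mul, Finset.sum_ite_eq',
            Finset.mem_univ, if_true, Finset.mul_sum]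
  have hright : weylCoeff v y * star (weylCoeff v y) =
      ∑ p, ∑ s, parity (p ⬝ᵥ y.2) *
        (v s * star (v (s + p)) * (star (v (s + y.1)) * v (s + y.1 + p))) := by
    rw [Finset.sum_comm]
    simp only [weylCoeff, star_sum, Finset.sum_mul_sum]
    refine Finset.sum_congr rfl fun s _ => ?_
    rw [← Equiv.sum_comp (Equiv.addLeft s)]
    refine Finset.sum_congr rfl fun p _ => ?_
    have hsq : parity (y.2 ⬝ᵥ s) * parity (y.2 ⬝ᵥ s) = 1 := by
      rw [← parity_add, CharTwo.add_self_eq_zero, parity_zero]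
    simp only [Equiv.coe_addLeft, dotProduct_add, parity_add, star_mul', star_parity, star_star,
      dotProduct_comm p y.2, add_right_comm s p y.1]
    linear_combination (v s * star (v (s + y.1)) * parity (y.2 ⬝ᵥ p) *
      (star (v (s + p)) * v (s + y.1 + p))) * hsq
  rw [Fintype.sum_prod_type, hright, Finset.mul_sum]
  exact Finset.sum_congr rfl fun p _ => hleft p

/-- The sign `(-1)^{[x, y]}` of the symplectic form, as a real number. -/
def sympSign {n : ℕ} (x y : Bits n × Bits n) : ℝ := (parity (x.1 ⬝ᵥ y.2 + x.2 ⬝ᵥ y.1)).re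

theorem ofReal_re_parity (a : ZMod 2) : ((parity a).re : ℂ) = parity a := by
  revert a
  simp [forall_zmod_two]

theorem sympSign_add_right {n : ℕ} (x y z : Bits n × Bits n) :
    sympSign x (y + z) = sympSign x y * sympSign x z := by
  apply Complex.ofReal_injective
  simp only [sympSign, Complex.ofReal_mul, ofReal_re_parity]
  simp only [Prod.fst_add, Prod.snd_add, dotProduct_add, parity_add]
  ring

theorem sympSign_comm {n : ℕ} (x y : Bits n × Bits n) : sympSign x y = sympSign y x := by
  rw [sympSign, sympSign, add_comm, dotProduct_comm x.1, dotProduct_comm x.2]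

theorem sum_sympSign_mul {n : ℕ} (ψ : PureState n) (y : Bits n × Bits n) :
    ∑ x, sympSign x y * ‖weylAmp ψ x‖ ^ 2 = 2 ^ n * ‖weylAmp ψ y‖ ^ 2 := by
  apply Complex.ofReal_injective
  have h := sum_parity_mul_weylCoeff (ψ : Space n).ofLp y
  simp only [← starRingEnd_apply, Complex.mul_conj, Complex.normSq_eq_norm_sq,
    ← norm_weylAmp_eq] at h
  push_cast at h ⊢
  simpa only [sympSign, ofReal_re_parity] using h

/-- The Weyl expectation is the normalized sixth moment of the amplitudes: both convolutions in it
are diagonalized by the symplectic Fourier transform. -/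
theorem weylExpectation_eq {n : ℕ} (ψ : PureState n) :
    weylExpectation ψ = (∑ x, ‖weylAmp ψ x‖ ^ 6) / 2 ^ n := by
  set f : Bits n × Bits n → ℝ := fun x => ‖weylAmp ψ x‖ ^ 2 with hf
  have hF : ∀ y, ∑ x, sympSign x y * f x = 2 ^ n * f y := sum_sympSign_mul ψ
  have h2 : (2 : ℝ) ^ n ≠ 0 := by positivity
  have key : (2 : ℝ) ^ n * ∑ x, ∑ y, f x * (f y * f (x + y)) = (2 ^ n) ^ 2 * ∑ z, f z ^ 3 := by
    calc _ = ∑ x, ∑ y, f x * (f y * ∑ z, sympSign z (x + y) * f z) := by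
          simp only [hF, Finset.mul_sum]
          exact Finset.sum_congr rfl fun x _ => Finset.sum_congr rfl fun y _ => by ring
      _ = ∑ z, f z * ((∑ x, sympSign x z * f x) * (∑ y, sympSign y z * f y)) := by
          simp only [Finset.sum_mul_sum]
          simp only [Finset.mul_sum]
          rw [Finset.sum_congr rfl fun x _ => Finset.sum_comm, Finset.sum_comm]
          refine Finset.sum_congr rfl fun z _ => Finset.sum_congr rfl fun x _ =>
            Finset.sum_congr rfl fun y _ => ?_
          rw [sympSign_add_right, sympSign_comm z x, sympSign_comm z y]
          ring
      _ = _ := by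
          simp only [hF, Finset.mul_sum]
          exact Finset.sum_congr rfl fun z _ => by ring
  have hE : weylExpectation ψ = (∑ x, ∑ y, f x * (f y * f (x + y))) / (2 ^ n) ^ 2 := by
    simp only [weylExpectation, weylDist, charDist, Finset.sum_mul, Finset.sum_div]
    refine Finset.sum_congr rfl fun x _ => Finset.sum_congr rfl fun y _ => ?_
    simp only [hf]
    field_simp
  have h6 : ∀ x, ‖weylAmp ψ x‖ ^ 6 = f x ^ 3 := fun x => by simp only [hf]; ring
  rw [hE, div_eq_div_iff (by positivity) h2]
  simp only [h6]
  linarith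

theorem weylAmp_zero {n : ℕ} (ψ : PureState n) : weylAmp ψ 0 = 1 := by
  have h : inner ℂ (ψ : Space n) (ψ : Space n) = 1 := by
    simp [inner_self_eq_norm_sq_to_K]
  rw [PiLp.inner_apply] at h
  simpa only [weylAmp_eq, weylCoeff, RCLike.inner_apply, Prod.fst_zero, Prod.snd_zero, Pi.zero_apply,
    ZMod.val_zero, mul_zero, Finset.sum_const_zero, pow_zero, one_mul, zero_dotProduct, parity_zero,
    add_zero, starRingEnd_apply] using h

theorem sum_norm_weylAmp_sq {n : ℕ} (ψ : PureState n) : ∑ x, ‖weylAmp ψ x‖ ^ 2 = 2 ^ n := by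
  simpa [sympSign, weylAmp_zero] using sum_sympSign_mul ψ 0

/-! ### Stabilizer fidelity bounds the Weyl expectation from below -/

theorem inner_act_left {n : ℕ} (A : Mat n) (v w : Space n) :
    inner ℂ (act A v) w = inner ℂ v (act Aᴴ w) := by
  simp only [act, EuclideanSpace.inner_eq_star_dotProduct, Matrix.star_mulVec]
  rw [dotProduct_comm, ← Matrix.dotProduct_mulVec, dotProduct_comm]

theorem act_act {n : ℕ} (A B : Mat n) (v : Space n) : act A (act B v) = act (A * B) v := by
  simp [act]

theorem act_one {n : ℕ} (v : Space n) : act 1 v = v := by simp [act]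

theorem act_smul {n : ℕ} (c : ℂ) (A : Mat n) (v : Space n) : act (c • A) v = c • act A v := by
  ext; simp [act, Matrix.smul_mulVec]

theorem norm_act_of_unitary {n : ℕ} {U : Mat n} (hU : Uᴴ * U = 1) (v : Space n) :
    ‖act U v‖ = ‖v‖ := by
  have h : inner ℂ (act U v) (act U v) = inner ℂ v v := by
    rw [inner_act_left, act_act, hU, act_one]
  rw [inner_self_eq_norm_sq_to_K, inner_self_eq_norm_sq_to_K] at h
  have h' : ‖act U v‖ ^ 2 = ‖v‖ ^ 2 := by exact_mod_cast h
  exact (sq_eq_sq₀ (norm_nonneg _) (norm_nonneg _)).mp h'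

/-- The weight of `|0ⁿ⟩` is the average of the expectations of the products of Pauli `Z`s. -/
theorem norm_zero_coord_sq_le {n : ℕ} (ψ : PureState n) :
    2 ^ n * ‖(ψ : Space n) 0‖ ^ 2 ≤ ∑ q : Bits n, ‖weylAmp ψ (0, q)‖ := by
  have h : ∑ q : Bits n, weylCoeff (ψ : Space n).ofLp (0, q) =
      ((2 ^ n * ‖(ψ : Space n) 0‖ ^ 2 : ℝ) : ℂ) := by
    simp only [weylCoeff]
    rw [Finset.sum_comm]
    simp only [← Finset.sum_mul, sum_parity_dotProduct, ite_mul, zero_mul, add_zero,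
      Finset.sum_ite_eq', Finset.mem_univ, if_true, ← starRingEnd_apply, Complex.mul_conj,
      Complex.normSq_eq_norm_sq]
    push_cast
    rfl
  calc 2 ^ n * ‖(ψ : Space n) 0‖ ^ 2 = ‖∑ q : Bits n, weylCoeff (ψ : Space n).ofLp (0, q)‖ := by
        rw [h, Complex.norm_real, Real.norm_of_nonneg (by positivity)]
    _ ≤ ∑ q : Bits n, ‖weylCoeff (ψ : Space n).ofLp (0, q)‖ := norm_sum_le _ _
    _ = _ := by simp only [norm_weylAmp_eq]

/-- The overlap with each single stabilizer state bounds the Weyl expectation from below. -/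
theorem fidelity_pow_six_le {n : ℕ} (ψ : PureState n) {φ : PureState n}
    (hφ : φ ∈ stabilizerStates n) :
    (‖inner ℂ (φ : Space n) (ψ : Space n)‖ ^ 2) ^ 6 ≤ weylExpectation ψ := by
  obtain ⟨C, hC, hφC⟩ := hφ
  obtain ⟨π, hπ⟩ := permutesWeyl_of_mem_cliffordGroup hC
  have hUU : (C : Mat n)ᴴ * (C : Mat n) = 1 := Matrix.mem_unitaryGroup_iff'.mp C.2
  have hUU' : (C : Mat n) * (C : Mat n)ᴴ = 1 := Matrix.mem_unitaryGroup_iff.mp C.2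
  have hinv : act (C : Mat n) (act (C : Mat n)ᴴ (ψ : Space n)) = ψ := by
    rw [act_act, hUU', act_one]
  let χ : PureState n := ⟨act (C : Mat n)ᴴ (ψ : Space n), by
    rw [mem_sphere_zero_iff_norm, norm_act_of_unitary (by simpa using hUU')]
    simp⟩
  have hamp : ∀ x, ‖weylAmp χ x‖ = ‖weylAmp ψ (π x)‖ := by
    intro x
    obtain ⟨c, hc, h⟩ := hπ x
    have : weylAmp χ x = c * weylAmp ψ (π x) := by
      change inner ℂ (act (C : Mat n)ᴴ (ψ : Space n)) (act (weyl x) (act (C : Mat n)ᴴ ψ)) = _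
      rw [inner_act_left, conjTranspose_conjTranspose, act_act, h, act_smul, ← act_act, hinv,
        inner_smul_right]
      rfl
    rw [this, norm_mul, hc, one_mul]
  have hoverlap : inner ℂ (φ : Space n) (ψ : Space n) = (χ : Space n) 0 := by
    rw [hφC, inner_act_left, ketZero, EuclideanSpace.inner_single_left]
    simp [χ]
  have h2 : (0 : ℝ) < 2 ^ n := by positivity
  have hcard : (Fintype.card (Bits n) : ℝ) = 2 ^ n := by simp [ZMod.card]
  rw [weylExpectation_eq, hoverlap]
  calc (‖(χ : Space n) 0‖ ^ 2) ^ 6 ≤ (∑ q : Bits n, (2 ^ n)⁻¹ * ‖weylAmp χ (0, q)‖) ^ 6 := by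
        gcongr
        rw [← Finset.mul_sum, ← div_eq_inv_mul, le_div_iff₀' h2]
        exact norm_zero_coord_sq_le χ
    _ ≤ ∑ q : Bits n, (2 ^ n)⁻¹ * ‖weylAmp χ (0, q)‖ ^ 6 := by
        refine Real.pow_arith_mean_le_arith_mean_pow _ _ _ (fun _ _ => by positivity) ?_
          (fun _ _ => norm_nonneg _) 6
        rw [Finset.sum_const, Finset.card_univ, nsmul_eq_mul, hcard, mul_inv_cancel₀ h2.ne']
    _ = (∑ q : Bits n, ‖weylAmp χ (0, q)‖ ^ 6) / 2 ^ n := by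
        rw [← Finset.mul_sum, ← div_eq_inv_mul]
    _ ≤ (∑ x, ‖weylAmp χ x‖ ^ 6) / 2 ^ n := by
        gcongr
        rw [Fintype.sum_prod_type]
        exact Finset.single_le_sum (f := fun p : Bits n => ∑ q : Bits n, ‖weylAmp χ (p, q)‖ ^ 6)
          (fun p _ => by positivity) (Finset.mem_univ 0)
    _ = (∑ x, ‖weylAmp ψ x‖ ^ 6) / 2 ^ n := by
        simp only [hamp]
        rw [Equiv.sum_comp π fun x => ‖weylAmp ψ x‖ ^ 6]

theorem inv_pow_six_le_weylExpectation {n : ℕ} (ψ : PureState n) {k : ℝ} (hk : 0 < k)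
    (h : 1 / k ≤ stabilizerFidelity ψ) : 1 / k ^ 6 ≤ weylExpectation ψ := by
  have hE : 0 ≤ weylExpectation ψ := by
    rw [weylExpectation_eq]; positivity
  have hzero : (⟨ketZero n, by simp [ketZero]⟩ : PureState n) ∈ stabilizerStates n :=
    ⟨1, one_mem _, by simp [act_one]⟩
  have hsup : stabilizerFidelity ψ ≤ weylExpectation ψ ^ ((6 : ℕ) : ℝ)⁻¹ := by
    refine csSup_le (Set.Nonempty.image _ ⟨_, hzero⟩) ?_
    rintro _ ⟨φ, hφ, rfl⟩
    refine (Real.le_rpow_inv_iff_of_pos (by positivity) hE (by norm_num)).mpr ?_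
    rw [Real.rpow_natCast]
    exact fidelity_pow_six_le ψ hφ
  calc 1 / k ^ 6 = (1 / k) ^ 6 := by rw [div_pow, one_pow]
    _ ≤ (weylExpectation ψ ^ ((6 : ℕ) : ℝ)⁻¹) ^ 6 := by
        gcongr; exact h.trans hsup
    _ = weylExpectation ψ := Real.rpow_inv_natCast_pow hE (by norm_num)

/-! ### Products of Weyl operators -/

theorem weyl_mul_apply {n : ℕ} (x y : Bits n × Bits n) (r s : Bits n) :
    (weyl x * weyl y) r s = Complex.I ^ (∑ j, (x.1 j).val * (x.2 j).val) *
      Complex.I ^ (∑ j, (y.1 j).val * (y.2 j).val) *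
      if r = s + (y.1 + x.1) then parity (x.2 ⬝ᵥ y.1 + (x.2 + y.2) ⬝ᵥ s) else 0 := by
  rw [Matrix.mul_apply, Finset.sum_eq_single (s + y.1)]
  · rw [weyl_apply, weyl_apply, if_pos rfl, add_assoc]
    split_ifs
    · simp only [dotProduct_add, add_dotProduct, parity_add]; ring
    · simp
  · intro k _ hk
    rw [weyl_apply y, if_neg hk]
    simp
  · simp

theorem I_pow_mul_I_pow {n : ℕ} (x : Bits n × Bits n) :
    Complex.I ^ (∑ j, (x.1 j).val * (x.2 j).val) * Complex.I ^ (∑ j, (x.1 j).val * (x.2 j).val) =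
      parity (x.2 ⬝ᵥ x.1) := by
  rw [← mul_pow, Complex.I_mul_I, dotProduct, parity_sum, ← Finset.prod_pow_eq_pow_sum]
  refine Finset.prod_congr rfl fun j _ => ?_
  generalize x.1 j = p
  generalize x.2 j = q
  revert p q
  simp [forall_zmod_two, ZMod.val_one]

theorem weyl_mul_self {n : ℕ} (x : Bits n × Bits n) : weyl x * weyl x = 1 := by
  ext r s
  rw [weyl_mul_apply, I_pow_mul_I_pow, bits_add_self, bits_add_self, add_zero, zero_dotProduct,
    add_zero, Matrix.one_apply]
  split_ifs
  · rw [← parity_add, CharTwo.add_self_eq_zero, parity_zero]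
  · simp

theorem weyl_isHermitian {n : ℕ} (x : Bits n × Bits n) : (weyl x)ᴴ = weyl x := by
  ext r s
  have hiff : s = r + x.1 ↔ r = s + x.1 := by
    constructor <;> rintro rfl <;> rw [add_assoc, bits_add_self, add_zero]
  have hI : star (Complex.I ^ (∑ j, (x.1 j).val * (x.2 j).val)) * parity (x.2 ⬝ᵥ x.1) =
      Complex.I ^ (∑ j, (x.1 j).val * (x.2 j).val) := by
    rw [← I_pow_mul_I_pow, ← mul_assoc, star_pow, ← mul_pow]
    simp
  rw [Matrix.conjTranspose_apply, weyl_apply, weyl_apply, star_mul']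
  simp only [hiff]
  split_ifs with h
  · subst h
    rw [star_parity, dotProduct_add, parity_add]
    linear_combination parity (x.2 ⬝ᵥ s) * hI
  · simp

theorem weyl_mul_comm {n : ℕ} (x y : Bits n × Bits n) :
    weyl x * weyl y = parity (x.1 ⬝ᵥ y.2 + x.2 ⬝ᵥ y.1) • (weyl y * weyl x) := by
  ext r s
  rw [Matrix.smul_apply, weyl_mul_apply, weyl_mul_apply, add_comm x.1 y.1, smul_eq_mul]
  split_ifs
  · have hsq : parity (y.2 ⬝ᵥ x.1) * parity (y.2 ⬝ᵥ x.1) = 1 := by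
      rw [← parity_add, CharTwo.add_self_eq_zero, parity_zero]
    rw [add_comm y.2 x.2, dotProduct_comm x.1 y.2, parity_add, parity_add, parity_add]
    linear_combination -(Complex.I ^ (∑ j, (x.1 j).val * (x.2 j).val) *
      Complex.I ^ (∑ j, (y.1 j).val * (y.2 j).val) * parity (x.2 ⬝ᵥ y.1) *
      parity ((x.2 + y.2) ⬝ᵥ s)) * hsq
  · simp

/-- The symplectic form is nondegenerate, so every nontrivial Weyl operator anticommutes with
another one. -/
theorem exists_anticommute {n : ℕ} {x : Bits n × Bits n} (hx : x ≠ 0) :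
    ∃ y, weyl y * weyl x = -(weyl x * weyl y) := by
  have h01 : ∀ a : ZMod 2, a ≠ 0 → a = 1 := by decide
  suffices ∃ y : Bits n × Bits n, y.1 ⬝ᵥ x.2 + y.2 ⬝ᵥ x.1 = 1 by
    obtain ⟨y, hy⟩ := this
    exact ⟨y, by rw [weyl_mul_comm, hy, parity_one, neg_one_smul]⟩
  by_cases h1 : x.1 = 0
  · have h2 : x.2 ≠ 0 := fun h2 => hx (Prod.ext h1 h2)
    obtain ⟨j, hj⟩ := Function.ne_iff.mp h2
    exact ⟨(Pi.single j 1, 0), by simp [h01 _ hj]⟩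
  · obtain ⟨j, hj⟩ := Function.ne_iff.mp h1
    exact ⟨(0, Pi.single j 1), by simp [h01 _ hj]⟩

/-! ### Haar-random states have small amplitudes -/

/-- An operator acting on the state space, as a real-linear map. -/
def realAct {n : ℕ} (A : Mat n) : Space n →ₗ[ℝ] Space n where
  toFun := act A
  map_add' v w := by simp [act, Matrix.mulVec_add]
  map_smul' c v := by
    ext r
    simp [act, Matrix.mulVec, dotProduct, Finset.mul_sum, mul_left_comm]

theorem realAct_mul {n : ℕ} (A B : Mat n) : realAct A * realAct B = realAct (A * B) :=
  LinearMap.ext fun v => act_act A B v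

theorem realAct_one {n : ℕ} : realAct (1 : Mat n) = 1 := LinearMap.ext act_one

theorem realAct_neg {n : ℕ} (A : Mat n) : realAct (-A) = -realAct A :=
  LinearMap.ext fun v => by
    change act (-A) v = -act A v
    simp [act, Matrix.neg_mulVec]

theorem real_inner_eq_re {n : ℕ} (v w : Space n) : inner ℝ v w = (inner ℂ v w).re := by
  simp [PiLp.inner_apply, RCLike.inner_apply, Complex.inner]

theorem realAct_isSymmetric {n : ℕ} {A : Mat n} (hA : Aᴴ = A) : (realAct A).IsSymmetric := by
  intro v w
  change inner ℝ (act A v) w = inner ℝ v (act A w)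
  rw [real_inner_eq_re, real_inner_eq_re, inner_act_left, hA]

theorem finrank_real_space (n : ℕ) : Module.finrank ℝ (Space n) = 2 * 2 ^ n := by
  rw [finrank_real_of_complex, finrank_euclideanSpace]
  simp [ZMod.card]

theorem weylAmp_im {n : ℕ} (ψ : PureState n) (x : Bits n × Bits n) : (weylAmp ψ x).im = 0 := by
  rw [← Complex.conj_eq_iff_im, weylAmp, inner_conj_symm, inner_act_left, weyl_isHermitian]

/-- One-sided tail bound for the expectation of a Hermitian involution that anticommutes with
some other involution. -/
theorem haarState_setOf_le {n : ℕ} {A B : Mat n} (hA : Aᴴ = A) (hAA : A * A = 1) (hBB : B * B = 1)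
    (hBA : B * A = -(A * B)) {t : ℝ} (ht0 : 0 ≤ t) (ht1 : t ≤ 1) :
    haarState n {ψ | t ≤ (inner ℂ (ψ : Space n) (act A ψ)).re} ≤
      ENNReal.ofReal (Real.exp (-(2 ^ n * t ^ 2 / 2))) := by
  have h := toSphere_setOf_le_inner (volume : Measure (Space n)) (V := realAct B) (W := realAct A)
    (by rw [realAct_mul, hBB, realAct_one]) (by rw [realAct_mul, hAA, realAct_one])
    (by rw [realAct_mul, realAct_mul, hBA, realAct_neg]) (realAct_isSymmetric hA) ht0 ht1
  have hexp : (Module.finrank ℝ (Space n) : ℝ) * (t ^ 2 / 4) = 2 ^ n * t ^ 2 / 2 := by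
    rw [finrank_real_space]; push_cast; ring
  simp only [real_inner_eq_re, hexp] at h
  have hne : (volume : Measure (Space n)).toSphere Set.univ ≠ 0 := by
    rw [Ne, Measure.measure_univ_eq_zero]
    exact Measure.toSphere_ne_zero _
  rw [haarState, Measure.smul_apply, smul_eq_mul, mul_comm, ← div_eq_mul_inv, Real.exp_neg,
    ENNReal.ofReal_inv_of_pos (Real.exp_pos _)]
  refine ENNReal.div_le_of_le_mul ?_
  rw [mul_comm, ← div_eq_mul_inv, ENNReal.le_div_iff_mul_le (Or.inl (by simp [Real.exp_pos]))
    (Or.inl ENNReal.ofReal_ne_top), mul_comm]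
  exact h

theorem haarState_setOf_le_norm_weylAmp {n : ℕ} {x : Bits n × Bits n} (hx : x ≠ 0) {t : ℝ}
    (ht0 : 0 ≤ t) (ht1 : t ≤ 1) :
    (haarState n).real {ψ | t ≤ ‖weylAmp ψ x‖} ≤ 2 * Real.exp (-(2 ^ n * t ^ 2 / 2)) := by
  obtain ⟨y, hy⟩ := exists_anticommute hx
  have hsub : {ψ : PureState n | t ≤ ‖weylAmp ψ x‖} ⊆
      {ψ | t ≤ (inner ℂ (ψ : Space n) (act (weyl x) ψ)).re} ∪
      {ψ | t ≤ (inner ℂ (ψ : Space n) (act (-weyl x) ψ)).re} := by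
    intro ψ hψ
    have hre : ‖weylAmp ψ x‖ = |(weylAmp ψ x).re| :=
      (Complex.abs_re_eq_norm.mpr (weylAmp_im ψ x)).symm
    have hneg : act (-weyl x) (ψ : Space n) = -act (weyl x) (ψ : Space n) := by
      simp [act, Matrix.neg_mulVec]
    rw [Set.mem_ofPred_eq, hre] at hψ
    rcases le_abs.mp hψ with h | h
    · exact Or.inl h
    · right
      rw [Set.mem_ofPred_eq, hneg, inner_neg_right]
      exact h
  refine ENNReal.toReal_le_of_le_ofReal (by positivity) ?_
  refine (measure_mono hsub).trans ((measure_union_le _ _).trans ?_)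
  rw [two_mul, ENNReal.ofReal_add (Real.exp_pos _).le (Real.exp_pos _).le]
  refine add_le_add ?_ ?_
  · exact haarState_setOf_le (weyl_isHermitian x) (weyl_mul_self x) (weyl_mul_self y) hy ht0 ht1
  · exact haarState_setOf_le (by rw [conjTranspose_neg, weyl_isHermitian])
      (by rw [neg_mul_neg, weyl_mul_self]) (weyl_mul_self y)
      (by rw [mul_neg, hy, neg_mul]) ht0 ht1

/-- Four of the six factors are bounded by `t`, and the remaining squares sum to `2ⁿ`; the trivial
Weyl operator contributes the term `2⁻ⁿ`. -/
theorem weylExpectation_le_of_forall_norm_le {n : ℕ} {ψ : PureState n} {t : ℝ}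
    (h : ∀ x ≠ 0, ‖weylAmp ψ x‖ ≤ t) : weylExpectation ψ ≤ (2 ^ n)⁻¹ + t ^ 4 := by
  classical
  have h2 : (0 : ℝ) < 2 ^ n := by positivity
  have hsum : ∑ x, ‖weylAmp ψ x‖ ^ 6 ≤ 1 + t ^ 4 * 2 ^ n := by
    rw [← sum_norm_weylAmp_sq ψ, ← Finset.add_sum_erase _ _ (Finset.mem_univ 0), weylAmp_zero,
      norm_one, one_pow, Finset.mul_sum]
    gcongr
    calc ∑ x ∈ Finset.univ.erase 0, ‖weylAmp ψ x‖ ^ 6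
        ≤ ∑ x ∈ Finset.univ.erase 0, t ^ 4 * ‖weylAmp ψ x‖ ^ 2 := by
          refine Finset.sum_le_sum fun x hx => ?_
          have : ‖weylAmp ψ x‖ ^ 6 = ‖weylAmp ψ x‖ ^ 4 * ‖weylAmp ψ x‖ ^ 2 := by ring
          rw [this]
          gcongr
          exact h x (Finset.ne_of_mem_erase hx)
      _ ≤ ∑ x, t ^ 4 * ‖weylAmp ψ x‖ ^ 2 :=
          Finset.sum_le_sum_of_subset_of_nonneg (Finset.erase_subset _ _)
            fun x _ _ => by positivity
  rw [weylExpectation_eq, div_le_iff₀ h2, add_mul, inv_mul_cancel₀ h2.ne']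
  exact hsum

theorem continuous_weylExpectation (n : ℕ) : Continuous (weylExpectation (n := n)) := by
  have hamp : ∀ x, Continuous fun ψ : PureState n => weylAmp ψ x := fun x =>
    continuous_subtype_val.inner
      ((LinearMap.continuous_of_finiteDimensional (realAct (weyl x))).comp continuous_subtype_val)
  simp only [funext weylExpectation_eq]
  exact (continuous_finsetSum _ fun x _ => (hamp x).norm.pow 6).div_const _

theorem haarState_setOf_weylExpectation_le {n : ℕ} (hn : 33 ≤ n) :
    1 - Real.exp (-(2 : ℝ) ^ ((n : ℝ) / 2 - 15)) ≤
      (haarState n).real {ψ | weylExpectation ψ ≤ (2 : ℝ) ^ (-((n : ℝ) / 2))} := by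
  -- All quantities are expressed through `u = 2 ^ (n / 4) ≥ 256`.
  set u : ℝ := (2 : ℝ) ^ ((n : ℝ) / 4) with hu
  have hu256 : 256 ≤ u := by
    have h8 : (2 : ℝ) ^ (8 : ℝ) = 256 := by norm_num
    rw [← h8, hu]
    refine Real.rpow_le_rpow_of_exponent_le (by norm_num) ?_
    have : (33 : ℝ) ≤ n := by exact_mod_cast hn
    linarith
  have hu0 : 0 < u := by linarith
  have hu2 : (2 : ℝ) ^ ((n : ℝ) / 2) = u ^ 2 := by
    rw [hu, ← Real.rpow_mul_natCast (by norm_num)]; congr 1; push_cast; ring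
  have hu4 : (2 : ℝ) ^ n = u ^ 4 := by
    rw [hu, ← Real.rpow_mul_natCast (by norm_num), ← Real.rpow_natCast]; congr 1; push_cast; ring
  have hthr : (2 : ℝ) ^ (-((n : ℝ) / 2)) = (u ^ 2)⁻¹ := by
    rw [Real.rpow_neg (by norm_num), hu2]
  have hgoal : (2 : ℝ) ^ ((n : ℝ) / 2 - 15) ≤ u ^ 2 := by
    rw [← hu2]
    exact Real.rpow_le_rpow_of_exponent_le (by norm_num) (by linarith)
  -- With `t⁴ = 2 ^ (-n / 2) / 4` the bound `2⁻ⁿ + t⁴` is below the threshold, and the tail exponent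
  -- `2ⁿ t² / 2 = u³ / 4` dominates both the `2 * 4ⁿ` of the union bound and the required `u²`.
  set t : ℝ := Real.sqrt (2 * u)⁻¹ with ht
  have ht0 : 0 ≤ t := Real.sqrt_nonneg _
  have ht2 : t ^ 2 = (2 * u)⁻¹ := Real.sq_sqrt (by positivity)
  have ht1 : t ≤ 1 := Real.sqrt_le_one.mpr (inv_le_one_of_one_le₀ (by linarith))
  set S : Set (PureState n) := {ψ | weylExpectation ψ ≤ (2 : ℝ) ^ (-((n : ℝ) / 2))} with hS
  have hSm : MeasurableSet S :=
    measurableSet_le (continuous_weylExpectation n).measurable measurable_const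
  have hsub : Sᶜ ⊆ ⋃ x ∈ (Finset.univ.erase (0 : Bits n × Bits n)),
      {ψ : PureState n | t ≤ ‖weylAmp ψ x‖} := by
    intro ψ hψ
    by_contra hcon
    simp only [Set.mem_iUnion, Finset.mem_erase, Finset.mem_univ, and_true, Set.mem_ofPred_eq,
      exists_prop, not_exists, not_and, not_le] at hcon
    refine hψ ((weylExpectation_le_of_forall_norm_le fun x hx => (hcon x hx).le).trans ?_)
    have ht4 : t ^ 4 = ((2 * u)⁻¹) ^ 2 := by rw [← ht2]; ring
    rw [hthr, ht4, hu4]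
    have : (u ^ 4)⁻¹ + ((2 * u)⁻¹) ^ 2 = (u ^ 2)⁻¹ * ((u ^ 2)⁻¹ + 1 / 4) := by
      field_simp
      ring
    rw [this]
    refine mul_le_of_le_one_right (by positivity) ?_
    have : (u ^ 2)⁻¹ ≤ 1 / 2 := by
      rw [inv_le_comm₀ (by positivity) (by norm_num)]; nlinarith
    linarith
  have hcard : ((Finset.univ.erase (0 : Bits n × Bits n)).card : ℝ) ≤ u ^ 8 := by
    have h1 : (Finset.univ.erase (0 : Bits n × Bits n)).card ≤ 2 ^ n * 2 ^ n := by
      refine (Finset.card_le_univ _).trans ?_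
      simp [ZMod.card]
    calc ((Finset.univ.erase (0 : Bits n × Bits n)).card : ℝ) ≤ 2 ^ n * 2 ^ n := by
          exact_mod_cast h1
      _ = u ^ 8 := by rw [hu4]; ring
  have hbad : (haarState n).real Sᶜ ≤ u ^ 8 * (2 * Real.exp (-(2 ^ n * t ^ 2 / 2))) := by
    refine (measureReal_mono hsub (measure_ne_top _ _)).trans
      ((measureReal_biUnion_finset_le _ _).trans ?_)
    refine (Finset.sum_le_sum fun x hx =>
      haarState_setOf_le_norm_weylAmp (Finset.ne_of_mem_erase hx) ht0 ht1).trans ?_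
    rw [Finset.sum_const, nsmul_eq_mul]
    gcongr
  have hnum : u ^ 8 * (2 * Real.exp (-(2 ^ n * t ^ 2 / 2))) ≤
      Real.exp (-(2 : ℝ) ^ ((n : ℝ) / 2 - 15)) := by
    have hexpu : u ≤ Real.exp u := by linarith [Real.add_one_le_exp u]
    have hexp2 : 2 ≤ Real.exp u := by linarith
    calc u ^ 8 * (2 * Real.exp (-(2 ^ n * t ^ 2 / 2)))
        ≤ Real.exp u ^ 8 * (Real.exp u * Real.exp (-(2 ^ n * t ^ 2 / 2))) := by gcongr
      _ = Real.exp (9 * u - u ^ 3 / 4) := by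
          rw [← Real.exp_nat_mul, ← Real.exp_add, ← Real.exp_add, ht2, hu4]
          congr 1
          push_cast
          field_simp
          ring
      _ ≤ Real.exp (-(2 : ℝ) ^ ((n : ℝ) / 2 - 15)) := by
          refine Real.exp_le_exp.mpr ?_
          have h3 : 256 * u ^ 2 ≤ u ^ 3 := by nlinarith [sq_nonneg u]
          nlinarith
  rw [measureReal_compl hSm, probReal_univ] at hbad
  linarith

end StabFid

end

theorem lemma3p1 (n : ℕ) :
    (∀ (ψ : StabFid.PureState n) (k : ℝ), 0 < k →
      1 / k ≤ StabFid.stabilizerFidelity ψ → 1 / k ^ 6 ≤ StabFid.weylExpectation ψ) ∧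
    (33 ≤ n →
      1 - Real.exp (-(2 : ℝ) ^ ((n : ℝ) / 2 - 15)) ≤
        (StabFid.haarState n).real
          {ψ | StabFid.weylExpectation ψ ≤ (2 : ℝ) ^ (-((n : ℝ) / 2))}) := by
  exact ⟨fun ψ _ hk h => StabFid.inv_pow_six_le_weylExpectation ψ hk h,
    StabFid.haarState_setOf_weylExpectation_le⟩
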